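/- Let $\Gamma$ be a finite bipartite distance-regular graph with vertex set $X$, path-length distance $\partial$, diameter $D\ge 4$, valency $k\ge 3$ and intersection numbers $b_i=|\{z\in X:\partial(y,z)=1,\ \partial(z,w)=i+1\}|$ (for any vertices $y,w$ with $\partial(y,w)=i$). Let $A_i$ be the $i$-th distance matrix of $\Gamma$ (entry $1$ at $(y,z)$ if $\partial(y,z)=i$, and $0$ otherwise), let $A=A_1$ be the adjacency matrix, let $\theta_0>\theta_1>\cdots>\theta_D$ be the distinct eigenvalues of $A$, and put $d=\lfloor D/2\rfloor$. For $n\in\{1,d\}$ define $$\tilde\theta_n=-1-\frac{b_2b_3}{\theta_n^2-b_2}$$ (the denominator is nonzero). Fix $x\in X$. For $0\le i\le D$ let $E_i^*$ be the diagonal matrix whose $(y,y)$ entry is $1$ if $\partial(x,y)=i$ and $0$ otherwise, and let $T=T(x)$ be the subalgebra of $\mathrm{Mat}_X(\mathbb C)$ generated by $A,E_0^*,\dots,E_D^*$. A $T$-module is a subspace $W$ of $\mathbb C^X$ with $BW\subseteq W$ for all $B\in T$. It is irreducible if it is nonzero and contains no $T$-modules other than $0$ and $W$. An isomorphism of $T$-modules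 is a linear bijection that commutes with every $B\in T$. An irreducible $T$-module $W$ is thin if $\dim E_i^*W\le 1$ for $0\le i\le D$, and its endpoint is $\min\{i: 0\le i\le D,\ E_i^*W\neq 0\}$. If $W$ is thin irreducible with endpoint $2$, then $E_2^*W$ is a one-dimensional space of eigenvectors (together with $0$) of $E_2^*A_2E_2^*$; the corresponding eigenvalue is called the local eigenvalue of $W$. Theorem. Choose $n\in\{1,d\}$ if $D$ is odd, and let $n=1$ if $D$ is even. Let $W$ be a thin irreducible $T$-module with endpoint $2$ and local eigenvalue $\tilde\theta_n$, and let $W'$ be an irreducible $T$-module. Then the following are equivalent: (i) $W$ and $W'$ are isomorphic as $T$-modules; (ii) $W'$ is thin with endpoint $2$ and local eigenvalue $\tilde\theta_n$. -/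

import Mathlib

open scoped Matrix

noncomputable section

namespace SimpleGraph

/-- The number of vertices at distance `i` from `y` and at distance `j` from `z`. -/
def sphereCount {X : Type*} [Fintype X] (Γ : SimpleGraph X) (i j : ℕ) (y z : X) : ℕ :=
  (Finset.univ.filter fun w : X => Γ.dist y w = i ∧ Γ.dist w z = j).card

/-- A connected graph is distance-regular if the number of vertices at distance `i` from `y` and
`j` from `z` depends only on `i`, `j` and the distance between `y` and `z`. -/
def IsDistanceRegular {X : Type*} [Fintype X] (Γ : SimpleGraph X) : Prop :=
  Γ.Connected ∧ ∀ (i j : ℕ) (y z y' z' : X), Γ.dist y z = Γ.dist y' z' →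
    Γ.sphereCount i j y z = Γ.sphereCount i j y' z'

open Classical in
/-- The intersection number `p^h_{ij}`: the value of `sphereCount i j` at a pair of vertices at
distance `h` (any such pair gives the same value if the graph is distance-regular). -/
def intersectionNumber {X : Type*} [Fintype X] (Γ : SimpleGraph X) (h i j : ℕ) : ℕ :=
  if H : ∃ q : X × X, Γ.dist q.1 q.2 = h then Γ.sphereCount i j H.choose.1 H.choose.2 else 0

/-- The intersection number `b_i = p^i_{1,i+1}`; in particular `b_0` is the valency. -/
def interB {X : Type*} [Fintype X] (Γ : SimpleGraph X) (i : ℕ) : ℕ :=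
  Γ.intersectionNumber i 1 (i + 1)

/-- The `i`-th distance matrix `A_i`; the adjacency matrix is `A = A_1`. -/
def distMatrix {X : Type*} (Γ : SimpleGraph X) (i : ℕ) : Matrix X X ℂ :=
  Matrix.of fun y z => if Γ.dist y z = i then 1 else 0

/-- The finite set of eigenvalues of `A`. As `A` is real symmetric, they are all real. -/
def eigenvalueFinset {X : Type*} [Fintype X] [DecidableEq X] (Γ : SimpleGraph X) : Finset ℝ :=
  (Matrix.finite_real_spectrum (A := Γ.distMatrix 1)).toFinset

/-- `θ_i`: the distinct eigenvalues of `A` are listed as `θ_0 > θ_1 > ⋯ > θ_D`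
(and `0` beyond the end of the list). -/
def theta {X : Type*} [Fintype X] [DecidableEq X] (Γ : SimpleGraph X) (i : ℕ) : ℝ :=
  (Γ.eigenvalueFinset.sort (· ≥ ·)).getD i 0

/-- `θ̃_i = -1 - b_2 b_3 / (θ_i² - b_2)`. -/
def thetaTilde {X : Type*} [Fintype X] [DecidableEq X] (Γ : SimpleGraph X) (i : ℕ) : ℝ :=
  -1 - (Γ.interB 2 : ℝ) * (Γ.interB 3 : ℝ) / (Γ.theta i ^ 2 - (Γ.interB 2 : ℝ))

/-- The dual idempotent `E*_i` with respect to `x`. -/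
def dualIdempotent {X : Type*} [DecidableEq X] (Γ : SimpleGraph X) (x : X) (i : ℕ) :
    Matrix X X ℂ :=
  Matrix.diagonal fun y => if Γ.dist x y = i then 1 else 0

/-- The subconstituent (Terwilliger) algebra `T(x)`, generated by `A` and the `E*_i`
(those with `i` above the diameter are zero). -/
def subconstituentAlgebra {X : Type*} [Fintype X] [DecidableEq X] (Γ : SimpleGraph X) (x : X) :
    Subalgebra ℂ (Matrix X X ℂ) :=
  Algebra.adjoin ℂ ({Γ.distMatrix 1} ∪ Set.range (Γ.dualIdempotent x))

/-- A `T(x)`-module: a subspace of the standard module `ℂ^X` that is invariant under `T(x)`. -/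
structure TModule {X : Type*} [Fintype X] [DecidableEq X] (Γ : SimpleGraph X) (x : X) where
  carrier : Submodule ℂ (X → ℂ)
  invariant : ∀ B ∈ Γ.subconstituentAlgebra x, ∀ w ∈ carrier, B *ᵥ w ∈ carrier

namespace TModule

/-- `W` is nonzero and contains no `T`-modules other than `0` and `W`. -/
def IsIrreducible {X : Type*} [Fintype X] [DecidableEq X] {Γ : SimpleGraph X} {x : X}
    (W : Γ.TModule x) : Prop :=
  W.carrier ≠ ⊥ ∧
    ∀ W₁ : Γ.TModule x, W₁.carrier ≤ W.carrier → W₁.carrier = ⊥ ∨ W₁.carrier = W.carrier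

/-- `W` and `W'` are isomorphic as `T`-modules. -/
def IsIsomorphic {X : Type*} [Fintype X] [DecidableEq X] {Γ : SimpleGraph X} {x : X}
    (W W' : Γ.TModule x) : Prop :=
  ∃ σ : W.carrier ≃ₗ[ℂ] W'.carrier,
    ∀ (B : Matrix X X ℂ) (hB : B ∈ Γ.subconstituentAlgebra x) (w : W.carrier),
      (σ ⟨B *ᵥ (w : X → ℂ), W.invariant B hB w w.2⟩ : X → ℂ) = B *ᵥ (σ w : X → ℂ)

/-- The subspace `E*_i W`. -/
def subconstituent {X : Type*} [Fintype X] [DecidableEq X] {Γ : SimpleGraph X} {x : X}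
    (W : Γ.TModule x) (i : ℕ) : Submodule ℂ (X → ℂ) :=
  W.carrier.map (Matrix.mulVecLin (Γ.dualIdempotent x i))

/-- `W` is thin: `dim E*_i W ≤ 1` for `0 ≤ i ≤ D`. -/
def IsThin {X : Type*} [Fintype X] [DecidableEq X] {Γ : SimpleGraph X} {x : X}
    (W : Γ.TModule x) : Prop :=
  ∀ i ≤ Γ.diam, Module.finrank ℂ (W.subconstituent i) ≤ 1

/-- The endpoint of `W`: the least `i` with `0 ≤ i ≤ D` and `E*_i W ≠ 0`
(such `i` exist whenever `W ≠ 0` and the graph is connected). -/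
def endpoint {X : Type*} [Fintype X] [DecidableEq X] {Γ : SimpleGraph X} {x : X}
    (W : Γ.TModule x) : ℕ :=
  sInf {i | i ≤ Γ.diam ∧ W.subconstituent i ≠ ⊥}

/-- `E*_2 W` is nonzero and is an eigenspace of `E*_2 A_2 E*_2` with eigenvalue `η`. For a thin
irreducible `W` with endpoint `2`, exactly one `η` satisfies this: the local eigenvalue of `W`. -/
def HasLocalEigenvalue {X : Type*} [Fintype X] [DecidableEq X] {Γ : SimpleGraph X} {x : X}
    (W : Γ.TModule x) (η : ℝ) : Prop :=
  W.subconstituent 2 ≠ ⊥ ∧ ∀ v ∈ W.subconstituent 2,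
    (Γ.dualIdempotent x 2 * Γ.distMatrix 2 * Γ.dualIdempotent x 2) *ᵥ v = (η : ℂ) • v

end TModule

end SimpleGraph

end

/-!
Split `A = R + L` into the raising and lowering matrices with respect to `x`. If `W` is thin
irreducible of endpoint `2` with local eigenvalue `η` and `v` spans `E*_2 W`, then the vectors
`w_j = E*_{j+2} A_j v` satisfy `R w_j = c_{j+1} w_{j+1}`. The three-term recurrence for `A A_j`,
together with `E*_{j+2} (A_j + A_{j+2} + A_{j+4}) v = 0` and thinness, gives by induction on `j`
that `L w_{j+1} = ξ_j w_j`, where `ξ_j` depends only on `η` and the intersection numbers. Hence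
every matrix in `T` acts on the `w_j` through coefficients that depend only on `η`; in particular,
for `B ∈ T` the scalar by which `E*_2 B` acts on `E*_2 W` depends only on `η`. These scalars
determine the annihilator of `v` in `T`, and `W` is the quotient of `T` by it.
-/

namespace Terwilliger

open SimpleGraph

section Distance

variable {X : Type*} {Γ : SimpleGraph X}

theorem even_dist_iff_of_coloring (hc : Γ.Connected) (c : Γ.Coloring Bool) (y z : X) :
    Even (Γ.dist y z) ↔ (c y = true ↔ c z = true) := by
  obtain ⟨p, hp⟩ := hc.exists_walk_length_eq_dist y z
  rw [← hp]
  exact c.even_length_iff_congr p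

theorem even_dist_add_dist_add_dist (hc : Γ.Connected) (hbip : Γ.IsBipartite) (x y z : X) :
    Even (Γ.dist x y + Γ.dist y z + Γ.dist x z) := by
  obtain ⟨c⟩ := hbip
  simp only [Nat.even_add, even_dist_iff_of_coloring hc (Γ.recolorOfEquiv finTwoEquiv c)]
  tauto

theorem dist_eq_dist_add_one_or_of_dist_eq_one (hc : Γ.Connected) (hbip : Γ.IsBipartite)
    (x : X) {y z : X} (h : Γ.dist y z = 1) :
    Γ.dist x y = Γ.dist x z + 1 ∨ Γ.dist x z = Γ.dist x y + 1 := by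
  have hadj := (dist_eq_one_iff_adj.1 h).diff_dist_adj (u := x)
  obtain ⟨r, hr⟩ := even_dist_add_dist_add_dist hc hbip x y z
  omega

theorem exists_dist_eq_one_and_dist_eq (hc : Γ.Connected) {y z : X} {i : ℕ}
    (h : Γ.dist y z = i + 1) : ∃ w, Γ.dist y w = 1 ∧ Γ.dist w z = i := by
  obtain ⟨p, hp⟩ := hc.exists_walk_length_eq_dist y z
  cases p with
  | nil => simp at h
  | @cons _ w _ hyw q =>
    have hyw' := dist_eq_one_iff_adj.2 hyw
    have hq := dist_le q
    have htri := hc.dist_triangle (u := y) (v := w) (w := z)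
    rw [Walk.length_cons] at hp
    exact ⟨w, hyw', by omega⟩

theorem distMatrix_zero [DecidableEq X] (hc : Γ.Connected) : Γ.distMatrix 0 = 1 := by
  ext y z
  simp [distMatrix, Matrix.one_apply, hc.dist_eq_zero_iff]

end Distance

section IntersectionNumbers

variable {X : Type*} [Fintype X] {Γ : SimpleGraph X}

theorem sphereCount_eq_intersectionNumber (hdr : Γ.IsDistanceRegular) (i j : ℕ) (y z : X) :
    Γ.sphereCount i j y z = Γ.intersectionNumber (Γ.dist y z) i j := by
  have H : ∃ q : X × X, Γ.dist q.1 q.2 = Γ.dist y z := ⟨(y, z), rfl⟩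
  rw [intersectionNumber, dif_pos H]
  exact hdr.2 i j _ _ _ _ H.choose_spec.symm

/-- The intersection number `c_i = p^i_{1,i-1}`. By truncated subtraction `c_0` is `p^0_{1,0}`,
which is `0` as it should be. -/
noncomputable def interC (Γ : SimpleGraph X) (i : ℕ) : ℕ :=
  Γ.intersectionNumber i 1 (i - 1)

theorem distMatrix_mul_distMatrix_apply (hdr : Γ.IsDistanceRegular) (i j : ℕ) (y z : X) :
    (Γ.distMatrix i * Γ.distMatrix j) y z = Γ.intersectionNumber (Γ.dist y z) i j := by
  rw [← sphereCount_eq_intersectionNumber hdr]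
  simp [Matrix.mul_apply, distMatrix, sphereCount, ← ite_and, and_comm]

theorem interC_one_smul_distMatrix_one (hdr : Γ.IsDistanceRegular) :
    (interC Γ 1 : ℂ) • Γ.distMatrix 1 = Γ.distMatrix 1 := by
  classical
  ext y z
  have hentry := distMatrix_mul_distMatrix_apply hdr 1 0 y z
  rw [distMatrix_zero hdr.1, mul_one] at hentry
  by_cases h : Γ.Adj y z
  · rw [dist_eq_one_iff_adj.2 h] at hentry
    rw [Matrix.smul_apply, interC, ← hentry]
    simp [distMatrix]
  · simp [distMatrix, h]

theorem distMatrix_eq_zero_of_interC_eq_zero (hdr : Γ.IsDistanceRegular) {i : ℕ}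
    (h : interC Γ (i + 1) = 0) : Γ.distMatrix (i + 1) = 0 := by
  ext y z
  suffices Γ.dist y z ≠ i + 1 by simp [distMatrix, this]
  intro hyz
  obtain ⟨w, hw⟩ := exists_dist_eq_one_and_dist_eq hdr.1 hyz
  have hcount : Γ.sphereCount 1 i y z = 0 := by
    rw [sphereCount_eq_intersectionNumber hdr, hyz]
    exact h
  rw [sphereCount, Finset.card_eq_zero, Finset.filter_eq_empty_iff] at hcount
  exact hcount (Finset.mem_univ w) hw

theorem sphereCount_one_succ_eq_zero (hc : Γ.Connected) (hbip : Γ.IsBipartite) {j : ℕ} {y z : X}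
    (hne : Γ.dist y z ≠ j) (hne' : Γ.dist y z ≠ j + 2) : Γ.sphereCount 1 (j + 1) y z = 0 := by
  rw [sphereCount, Finset.card_eq_zero, Finset.filter_eq_empty_iff]
  rintro w - ⟨hyw, hwz⟩
  have hdist := dist_eq_dist_add_one_or_of_dist_eq_one hc hbip z hyw
  rw [dist_comm, dist_comm (v := w), hwz] at hdist
  omega

theorem distMatrix_one_mul_distMatrix_succ (hdr : Γ.IsDistanceRegular) (hbip : Γ.IsBipartite)
    (j : ℕ) : Γ.distMatrix 1 * Γ.distMatrix (j + 1) =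
      (interC Γ (j + 2) : ℂ) • Γ.distMatrix (j + 2) + (Γ.interB j : ℂ) • Γ.distMatrix j := by
  ext y z
  rw [distMatrix_mul_distMatrix_apply hdr]
  by_cases hlow : Γ.dist y z = j
  · simp [distMatrix, hlow, interB]
  by_cases hhigh : Γ.dist y z = j + 2
  · simp [distMatrix, hhigh, interC]
  · rw [← sphereCount_eq_intersectionNumber hdr, sphereCount_one_succ_eq_zero hdr.1 hbip hlow hhigh]
    simp [distMatrix, hlow, hhigh]

end IntersectionNumbers

section RaisingLowering

variable {X : Type*} {Γ : SimpleGraph X} {x : X}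

/-- The raising matrix `R = ∑ i, E*_{i+1} A E*_i` with respect to `x`. -/
noncomputable def raisingMatrix (Γ : SimpleGraph X) (x : X) : Matrix X X ℂ :=
  Matrix.of fun y z => if Γ.dist y z = 1 ∧ Γ.dist x y = Γ.dist x z + 1 then 1 else 0

/-- The lowering matrix `L = ∑ i, E*_i A E*_{i+1}` with respect to `x`, encoded as the adjoint of
the raising matrix. -/
noncomputable def loweringMatrix (Γ : SimpleGraph X) (x : X) : Matrix X X ℂ :=
  (raisingMatrix Γ x)ᴴ

theorem distMatrix_one_eq_raisingMatrix_add_loweringMatrix (hc : Γ.Connected)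
    (hbip : Γ.IsBipartite) (x : X) :
    Γ.distMatrix 1 = raisingMatrix Γ x + loweringMatrix Γ x := by
  ext y z
  by_cases h : Γ.dist y z = 1
  · have hzy : Γ.dist z y = 1 := dist_comm.trans h
    rcases dist_eq_dist_add_one_or_of_dist_eq_one hc hbip x h with hx | hx <;>
      simp [distMatrix, raisingMatrix, loweringMatrix, h, hzy, hx, add_assoc]
  · have hzy : Γ.dist z y ≠ 1 := dist_comm.trans_ne h
    simp [distMatrix, raisingMatrix, loweringMatrix, h, hzy]

theorem star_raisingMatrix_mulVec_dotProduct [Fintype X] (u w : X → ℂ) :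
    star (raisingMatrix Γ x *ᵥ u) ⬝ᵥ w = star u ⬝ᵥ loweringMatrix Γ x *ᵥ w := by
  rw [Matrix.star_mulVec, Matrix.dotProduct_mulVec, loweringMatrix]

variable [DecidableEq X]

theorem conjTranspose_dualIdempotent (i : ℕ) :
    (Γ.dualIdempotent x i)ᴴ = Γ.dualIdempotent x i := by
  rw [dualIdempotent, Matrix.diagonal_conjTranspose]
  congr 1
  ext y
  simp [apply_ite]

theorem dualIdempotent_eq_zero [Finite X] (hc : Γ.Connected) {i : ℕ} (h : Γ.diam < i) :
    Γ.dualIdempotent x i = 0 := by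
  have : Nonempty X := ⟨x⟩
  rw [dualIdempotent, Matrix.diagonal_eq_zero]
  ext y
  exact if_neg ((dist_le_diam (connected_iff_ediam_ne_top.1 hc)).trans_lt h).ne

variable [Fintype X]

theorem dualIdempotent_mul_dualIdempotent (i j : ℕ) :
    Γ.dualIdempotent x i * Γ.dualIdempotent x j = if i = j then Γ.dualIdempotent x i else 0 := by
  rw [dualIdempotent, dualIdempotent, Matrix.diagonal_mul_diagonal]
  split_ifs with h
  · simp [h]
  · rw [Matrix.diagonal_eq_zero]
    ext y
    simp +contextual [Ne.symm h]

theorem dualIdempotent_mulVec_apply (i : ℕ) (w : X → ℂ) (y : X) :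
    (Γ.dualIdempotent x i *ᵥ w) y = if Γ.dist x y = i then w y else 0 := by
  simp [dualIdempotent, Matrix.mulVec_diagonal]

theorem dualIdempotent_succ_mul_raisingMatrix (i : ℕ) :
    Γ.dualIdempotent x (i + 1) * raisingMatrix Γ x =
      raisingMatrix Γ x * Γ.dualIdempotent x i := by
  ext y z
  simp only [dualIdempotent, Matrix.diagonal_mul, Matrix.mul_diagonal, raisingMatrix,
    Matrix.of_apply, ite_mul, one_mul, zero_mul, ← ite_and]
  congr 1
  simp only [eq_iff_iff]
  omega

theorem dualIdempotent_mul_loweringMatrix (i : ℕ) :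
    Γ.dualIdempotent x i * loweringMatrix Γ x =
      loweringMatrix Γ x * Γ.dualIdempotent x (i + 1) := by
  simpa only [loweringMatrix, Matrix.conjTranspose_mul, conjTranspose_dualIdempotent] using
    (congrArg Matrix.conjTranspose (dualIdempotent_succ_mul_raisingMatrix (Γ := Γ) i)).symm

theorem dualIdempotent_succ_mul_distMatrix_one (hc : Γ.Connected) (hbip : Γ.IsBipartite) (i : ℕ) :
    Γ.dualIdempotent x (i + 1) * Γ.distMatrix 1 =
      raisingMatrix Γ x * Γ.dualIdempotent x i +
        loweringMatrix Γ x * Γ.dualIdempotent x (i + 2) := by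
  rw [distMatrix_one_eq_raisingMatrix_add_loweringMatrix hc hbip x, mul_add,
    dualIdempotent_succ_mul_raisingMatrix, dualIdempotent_mul_loweringMatrix]

end RaisingLowering

section Components

variable {X : Type*} [Fintype X] [DecidableEq X] {Γ : SimpleGraph X} {x : X} {v : X → ℂ}

/-- The component `E*_i A_j v` of `A_j v` on the sphere of radius `i` around the base vertex. -/
noncomputable def component (Γ : SimpleGraph X) (x : X) (v : X → ℂ) (i j : ℕ) : X → ℂ :=
  Γ.dualIdempotent x i *ᵥ Γ.distMatrix j *ᵥ v

/-- The vector `w_j = E*_{j+2} A_j v`. For `v` spanning `E*_2 W`, with `W` thin irreducible of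
endpoint `2`, these are the vectors that span `W`. -/
noncomputable def ladder (Γ : SimpleGraph X) (x : X) (v : X → ℂ) (j : ℕ) : X → ℂ :=
  component Γ x v (j + 2) j

theorem component_apply (i j : ℕ) (y : X) :
    component Γ x v i j y =
      if Γ.dist x y = i then ∑ z, if Γ.dist y z = j then v z else 0 else 0 := by
  rw [component, dualIdempotent_mulVec_apply]
  simp [Matrix.mulVec, dotProduct, distMatrix]

theorem dualIdempotent_mulVec_component (i j m : ℕ) :
    Γ.dualIdempotent x m *ᵥ component Γ x v i j = if m = i then component Γ x v i j else 0 := by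
  rw [component, Matrix.mulVec_mulVec, dualIdempotent_mul_dualIdempotent]
  split_ifs with h
  · rw [h]
  · exact Matrix.zero_mulVec _

theorem component_zero (hc : Γ.Connected) {i : ℕ} (hv : Γ.dualIdempotent x i *ᵥ v = v) :
    component Γ x v i 0 = v := by
  rw [component, distMatrix_zero hc, Matrix.one_mulVec, hv]

theorem apply_eq_zero_of_dist_ne {r : ℕ} (hv : Γ.dualIdempotent x r *ᵥ v = v) {z : X}
    (hz : Γ.dist x z ≠ r) : v z = 0 := by
  rw [← hv, dualIdempotent_mulVec_apply, if_neg hz]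

theorem dualIdempotent_mulVec_eq_zero {r m : ℕ} (hv : Γ.dualIdempotent x r *ᵥ v = v) (h : m ≠ r) :
    Γ.dualIdempotent x m *ᵥ v = 0 := by
  rw [← hv, Matrix.mulVec_mulVec, dualIdempotent_mul_dualIdempotent, if_neg h, Matrix.zero_mulVec]

theorem raisingMatrix_mulVec_eq_component (hc : Γ.Connected) (hbip : Γ.IsBipartite) {r : ℕ}
    (hv : Γ.dualIdempotent x r *ᵥ v = v) :
    raisingMatrix Γ x *ᵥ v = component Γ x v (r + 1) 1 := by
  rw [component, Matrix.mulVec_mulVec, dualIdempotent_succ_mul_distMatrix_one hc hbip,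
    Matrix.add_mulVec, ← Matrix.mulVec_mulVec, ← Matrix.mulVec_mulVec, hv,
    dualIdempotent_mulVec_eq_zero hv (m := r + 2) (by omega), Matrix.mulVec_zero, add_zero]

theorem loweringMatrix_mulVec_eq_component (hc : Γ.Connected) (hbip : Γ.IsBipartite) {r : ℕ}
    (hv : Γ.dualIdempotent x (r + 2) *ᵥ v = v) :
    loweringMatrix Γ x *ᵥ v = component Γ x v (r + 1) 1 := by
  rw [component, Matrix.mulVec_mulVec, dualIdempotent_succ_mul_distMatrix_one hc hbip,
    Matrix.add_mulVec, ← Matrix.mulVec_mulVec, ← Matrix.mulVec_mulVec, hv,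
    dualIdempotent_mulVec_eq_zero hv (m := r) (by omega), Matrix.mulVec_zero, zero_add]

theorem component_eq_zero (hc : Γ.Connected) {r i j : ℕ} (hv : Γ.dualIdempotent x r *ᵥ v = v)
    (h : j + r < i ∨ i + r < j) : component Γ x v i j = 0 := by
  ext y
  rw [component_apply, Pi.zero_apply, ite_eq_right_iff]
  intro hy
  refine Finset.sum_eq_zero fun z _ =>
    ite_eq_right_iff.2 fun hyz => apply_eq_zero_of_dist_ne hv fun hz => ?_
  have hxy := hc.dist_triangle (u := x) (v := z) (w := y)
  have hzy := hc.dist_triangle (u := y) (v := x) (w := z)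
  rw [dist_comm (u := z)] at hxy
  rw [dist_comm (u := y) (v := x)] at hzy
  omega

theorem raisingMatrix_mulVec_component_add (hdr : Γ.IsDistanceRegular) (hbip : Γ.IsBipartite)
    (i j : ℕ) :
    raisingMatrix Γ x *ᵥ component Γ x v i (j + 1) +
        loweringMatrix Γ x *ᵥ component Γ x v (i + 2) (j + 1) =
      (interC Γ (j + 2) : ℂ) • component Γ x v (i + 1) (j + 2) +
        (Γ.interB j : ℂ) • component Γ x v (i + 1) j := by
  have h := congrArg (· *ᵥ Γ.distMatrix (j + 1) *ᵥ v)
    (dualIdempotent_succ_mul_distMatrix_one (x := x) hdr.1 hbip i)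
  simp only [Matrix.add_mulVec, ← Matrix.mulVec_mulVec] at h
  rw [component, component, ← h, Matrix.mulVec_mulVec v,
    distMatrix_one_mul_distMatrix_succ hdr hbip]
  simp only [component, Matrix.add_mulVec, Matrix.smul_mulVec, Matrix.mulVec_add,
    Matrix.mulVec_smul]

theorem raisingMatrix_mulVec_component (hdr : Γ.IsDistanceRegular) (hbip : Γ.IsBipartite) {r : ℕ}
    (hv : Γ.dualIdempotent x r *ᵥ v = v) (j : ℕ) :
    raisingMatrix Γ x *ᵥ component Γ x v (j + r) j =
      (interC Γ (j + 1) : ℂ) • component Γ x v (j + 1 + r) (j + 1) := by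
  cases j with
  | zero =>
    rw [zero_add, zero_add, component_zero hdr.1 hv, component, ← Matrix.mulVec_smul,
      ← Matrix.smul_mulVec, interC_one_smul_distMatrix_one hdr, add_comm]
    exact raisingMatrix_mulVec_eq_component hdr.1 hbip hv
  | succ j =>
    have h := raisingMatrix_mulVec_component_add (x := x) (v := v) hdr hbip (j + 1 + r) j
    rw [component_eq_zero hdr.1 hv (i := j + 1 + r + 2) (by omega),
      component_eq_zero hdr.1 hv (i := j + 1 + r + 1) (j := j) (by omega), Matrix.mulVec_zero,
      smul_zero, add_zero, add_zero] at h
    rw [h, show j + 1 + r + 1 = j + 1 + 1 + r by omega]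

theorem component_add_component_add_component (hc : Γ.Connected) (hbip : Γ.IsBipartite)
    (hv : Γ.dualIdempotent x 2 *ᵥ v = v) (hsum : ∑ y, v y = 0) (j : ℕ) :
    component Γ x v (j + 2) j + component Γ x v (j + 2) (j + 2) +
      component Γ x v (j + 2) (j + 4) = 0 := by
  ext y
  simp only [Pi.add_apply, component_apply, Pi.zero_apply]
  split_ifs with hy
  · rw [← Finset.sum_add_distrib, ← Finset.sum_add_distrib]
    refine (Finset.sum_congr rfl fun z _ => ?_).trans hsum
    by_cases hz : Γ.dist x z = 2
    · have hxy := hc.dist_triangle (u := x) (v := z) (w := y)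
      have hyz := hc.dist_triangle (u := y) (v := x) (w := z)
      rw [dist_comm (u := z)] at hxy
      rw [dist_comm (u := y) (v := x)] at hyz
      obtain ⟨m, hm⟩ := even_dist_add_dist_add_dist hc hbip x y z
      have hcases : Γ.dist y z = j ∨ Γ.dist y z = j + 2 ∨ Γ.dist y z = j + 4 := by omega
      rcases hcases with h | h | h <;> simp [h]
    · simp [apply_eq_zero_of_dist_ne hv hz]
  · simp

end Components
section Coefficients

variable {X : Type*} [Fintype X] {Γ : SimpleGraph X}

/-- The ratio `q_j` given by `E*_{j+2} A_{j+2} v = q_{j+1} w_j`, where `v` is a local vector with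
eigenvalue `η`. The denominator is nonzero if `w_{j+1} ≠ 0`; the values beyond that are junk. -/
noncomputable def diagRatio (Γ : SimpleGraph X) (η : ℂ) : ℕ → ℂ
  | 0 => 0
  | 1 => η
  | j + 2 => -1 + Γ.interB (j + 4) * (1 + diagRatio Γ η (j + 1)) /
      (Γ.interB j + interC Γ (j + 2) * diagRatio Γ η (j + 1) - interC Γ j * diagRatio Γ η j)

/-- The scalar `ξ_j` given by `L w_{j+1} = ξ_j w_j`. -/
noncomputable def lowerCoeff (Γ : SimpleGraph X) (η : ℂ) (j : ℕ) : ℂ :=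
  Γ.interB j + interC Γ (j + 2) * diagRatio Γ η (j + 1) - interC Γ j * diagRatio Γ η j

theorem diagRatio_add_two (η : ℂ) (j : ℕ) : diagRatio Γ η (j + 2) =
    -1 + Γ.interB (j + 4) * (1 + diagRatio Γ η (j + 1)) / lowerCoeff Γ η j := by
  rw [diagRatio, lowerCoeff]

end Coefficients

section LocalVectors

variable {X : Type*} [Fintype X] [DecidableEq X] {Γ : SimpleGraph X} {x : X} {v : X → ℂ} {η : ℂ}

/-- A vector that behaves like a generator of `E*_2 W` for a thin irreducible module `W` of endpoint
`2` and local eigenvalue `η`: the conditions on components say that `E*_0 W` and `E*_1 W` vanish,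
that `E*_2 A_2 E*_2` acts on `v` as `η`, and that `E*_{j+2} W` is spanned by `w_j` if `w_j ≠ 0`. -/
structure IsLocalVector (Γ : SimpleGraph X) (x : X) (η : ℂ) (v : X → ℂ) : Prop where
  ne_zero : v ≠ 0
  support : Γ.dualIdempotent x 2 *ᵥ v = v
  sum_eq_zero : ∑ y, v y = 0
  component_one_one : component Γ x v 1 1 = 0
  component_two_two : component Γ x v 2 2 = η • v
  thin : ∀ j, ladder Γ x v j ≠ 0 → component Γ x v (j + 2) (j + 4) ∈ ℂ ∙ ladder Γ x v j

theorem ladder_zero (hc : Γ.Connected) (hv : Γ.dualIdempotent x 2 *ᵥ v = v) :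
    ladder Γ x v 0 = v :=
  component_zero hc hv

theorem raisingMatrix_mulVec_ladder (hdr : Γ.IsDistanceRegular) (hbip : Γ.IsBipartite)
    (hv : Γ.dualIdempotent x 2 *ᵥ v = v) (j : ℕ) :
    raisingMatrix Γ x *ᵥ ladder Γ x v j = (interC Γ (j + 1) : ℂ) • ladder Γ x v (j + 1) :=
  raisingMatrix_mulVec_component hdr hbip hv j

theorem interC_ne_zero_of_component_ne_zero (hdr : Γ.IsDistanceRegular) {i j : ℕ}
    (h : component Γ x v i (j + 1) ≠ 0) : (interC Γ (j + 1) : ℂ) ≠ 0 := by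
  refine Nat.cast_ne_zero.2 fun h0 => h ?_
  rw [component, distMatrix_eq_zero_of_interC_eq_zero hdr h0, Matrix.zero_mulVec,
    Matrix.mulVec_zero]

theorem ladder_succ_eq_zero (hdr : Γ.IsDistanceRegular) (hbip : Γ.IsBipartite)
    (hv : Γ.dualIdempotent x 2 *ᵥ v = v) {j : ℕ} (h : ladder Γ x v j = 0) :
    ladder Γ x v (j + 1) = 0 := by
  by_contra hne
  have hraise := raisingMatrix_mulVec_ladder hdr hbip hv j
  rw [h, Matrix.mulVec_zero] at hraise
  exact smul_ne_zero (interC_ne_zero_of_component_ne_zero hdr hne) hne hraise.symm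

theorem loweringMatrix_mulVec_component (hdr : Γ.IsDistanceRegular) (hbip : Γ.IsBipartite) {r : ℕ}
    (hv : Γ.dualIdempotent x r *ᵥ v = v) (i : ℕ) :
    loweringMatrix Γ x *ᵥ component Γ x v (i + 2) (i + 2 + r) =
      (Γ.interB (i + 1 + r) : ℂ) • component Γ x v (i + 1) (i + 1 + r) := by
  have h := raisingMatrix_mulVec_component_add (x := x) (v := v) hdr hbip i (i + 1 + r)
  rw [component_eq_zero hdr.1 hv (i := i) (by omega),
    component_eq_zero hdr.1 hv (i := i + 1) (j := i + 1 + r + 2) (by omega), Matrix.mulVec_zero,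
    smul_zero, zero_add, zero_add] at h
  rw [← h, show i + 1 + r + 1 = i + 2 + r by omega]

theorem loweringMatrix_mulVec_ladder_succ_of_diag (hdr : Γ.IsDistanceRegular)
    (hbip : Γ.IsBipartite) {j : ℕ}
    (hdiag : component Γ x v (j + 2) (j + 2) = diagRatio Γ η (j + 1) • ladder Γ x v j)
    (hraise : raisingMatrix Γ x *ᵥ component Γ x v (j + 1) (j + 1) =
      (interC Γ j * diagRatio Γ η j) • ladder Γ x v j) :
    loweringMatrix Γ x *ᵥ ladder Γ x v (j + 1) = lowerCoeff Γ η j • ladder Γ x v j := by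
  have h := raisingMatrix_mulVec_component_add (x := x) (v := v) hdr hbip (j + 1) j
  rw [hraise, hdiag, ← ladder, ← eq_sub_iff_add_eq'] at h
  rw [h, lowerCoeff, show component Γ x v (j + 1 + 1) j = ladder Γ x v j from rfl]
  module

theorem ne_zero_of_loweringMatrix_mulVec_ladder_succ (hdr : Γ.IsDistanceRegular)
    (hbip : Γ.IsBipartite) (hv : Γ.dualIdempotent x 2 *ᵥ v = v) {j : ℕ} {ξ : ℂ}
    (hlower : loweringMatrix Γ x *ᵥ ladder Γ x v (j + 1) = ξ • ladder Γ x v j)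
    (h : ladder Γ x v (j + 1) ≠ 0) : ξ ≠ 0 := by
  -- By adjointness of `R` and `L`, the case `ξ = 0` would force `c_{j+1} ‖w_{j+1}‖² = 0`.
  rintro rfl
  have hadj := star_raisingMatrix_mulVec_dotProduct (Γ := Γ) (x := x) (ladder Γ x v j)
    (ladder Γ x v (j + 1))
  rw [hlower, zero_smul, dotProduct_zero, raisingMatrix_mulVec_ladder hdr hbip hv, star_smul,
    smul_dotProduct, smul_eq_zero, star_eq_zero] at hadj
  rcases hadj with hcoeff | hnorm
  · exact interC_ne_zero_of_component_ne_zero hdr h hcoeff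
  · open scoped ComplexOrder in exact h (dotProduct_star_self_eq_zero.1 hnorm)

namespace IsLocalVector

theorem component_succ_of_diag (hdr : Γ.IsDistanceRegular) (hbip : Γ.IsBipartite)
    (hv : IsLocalVector Γ x η v) {j : ℕ} (h : ladder Γ x v (j + 1) ≠ 0)
    (hdiag : component Γ x v (j + 2) (j + 2) = diagRatio Γ η (j + 1) • ladder Γ x v j)
    (hlower : loweringMatrix Γ x *ᵥ ladder Γ x v (j + 1) = lowerCoeff Γ η j • ladder Γ x v j) :
    component Γ x v (j + 3) (j + 3) = diagRatio Γ η (j + 2) • ladder Γ x v (j + 1) := by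
  have hξ := ne_zero_of_loweringMatrix_mulVec_ladder_succ hdr hbip hv.support hlower h
  have hw : ladder Γ x v j ≠ 0 := mt (ladder_succ_eq_zero hdr hbip hv.support) h
  -- Applying `L` to `E*_{j+3} A_{j+5} v = γ w_{j+1}` determines `γ`.
  obtain ⟨γ, hγ⟩ := Submodule.mem_span_singleton.1 (hv.thin (j + 1) h)
  have hsum := component_add_component_add_component hdr.1 hbip hv.support hv.sum_eq_zero
  have hupper : component Γ x v (j + 2) (j + 4) =
      -(1 + diagRatio Γ η (j + 1)) • ladder Γ x v j := by
    rw [eq_neg_of_add_eq_zero_right (hsum j), hdiag, ← ladder]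
    module
  have hγ_eq : γ * lowerCoeff Γ η j = Γ.interB (j + 4) * -(1 + diagRatio Γ η (j + 1)) := by
    refine smul_left_injective ℂ hw ?_
    have h4 := loweringMatrix_mulVec_component hdr hbip hv.support (j + 1)
    rwa [← hγ, Matrix.mulVec_smul, hlower, hupper, smul_smul, smul_smul] at h4
  have hdiag_succ := eq_neg_of_add_eq_zero_right ((add_right_comm _ _ _).trans (hsum (j + 1)))
  rw [hdiag_succ, ← hγ, ← ladder, diagRatio_add_two, eq_div_of_mul_eq hξ hγ_eq]
  module

theorem component_diag (hdr : Γ.IsDistanceRegular) (hbip : Γ.IsBipartite)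
    (hv : IsLocalVector Γ x η v) {j : ℕ} (h : ladder Γ x v j ≠ 0) :
    component Γ x v (j + 2) (j + 2) = diagRatio Γ η (j + 1) • ladder Γ x v j ∧
      raisingMatrix Γ x *ᵥ component Γ x v (j + 1) (j + 1) =
        (interC Γ j * diagRatio Γ η j) • ladder Γ x v j := by
  induction j with
  | zero =>
    rw [ladder_zero hdr.1 hv.support, hv.component_one_one, Matrix.mulVec_zero]
    exact ⟨hv.component_two_two, by simp [diagRatio]⟩
  | succ j ih =>
    obtain ⟨hdiag, hraise⟩ := ih (mt (ladder_succ_eq_zero hdr hbip hv.support) h)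
    have hlower := loweringMatrix_mulVec_ladder_succ_of_diag hdr hbip hdiag hraise
    refine ⟨hv.component_succ_of_diag hdr hbip h hdiag hlower, ?_⟩
    rw [hdiag, Matrix.mulVec_smul, raisingMatrix_mulVec_ladder hdr hbip hv.support, smul_smul,
      mul_comm]

theorem loweringMatrix_mulVec_ladder_zero (hc : Γ.Connected) (hbip : Γ.IsBipartite)
    (hv : IsLocalVector Γ x η v) : loweringMatrix Γ x *ᵥ ladder Γ x v 0 = 0 := by
  rw [ladder_zero hc hv.support, loweringMatrix_mulVec_eq_component hc hbip hv.support,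
    hv.component_one_one]

theorem loweringMatrix_mulVec_ladder_succ (hdr : Γ.IsDistanceRegular) (hbip : Γ.IsBipartite)
    (hv : IsLocalVector Γ x η v) (j : ℕ) :
    loweringMatrix Γ x *ᵥ ladder Γ x v (j + 1) = lowerCoeff Γ η j • ladder Γ x v j := by
  by_cases h : ladder Γ x v j = 0
  · rw [h, ladder_succ_eq_zero hdr hbip hv.support h, Matrix.mulVec_zero, smul_zero]
  · exact (hv.component_diag hdr hbip h).elim (loweringMatrix_mulVec_ladder_succ_of_diag hdr hbip)

theorem distMatrix_one_mulVec_ladder_zero (hdr : Γ.IsDistanceRegular) (hbip : Γ.IsBipartite)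
    (hv : IsLocalVector Γ x η v) :
    Γ.distMatrix 1 *ᵥ ladder Γ x v 0 = (interC Γ 1 : ℂ) • ladder Γ x v 1 := by
  rw [distMatrix_one_eq_raisingMatrix_add_loweringMatrix hdr.1 hbip x, Matrix.add_mulVec,
    hv.loweringMatrix_mulVec_ladder_zero hdr.1 hbip,
    raisingMatrix_mulVec_ladder hdr hbip hv.support, add_zero]

theorem distMatrix_one_mulVec_ladder_succ (hdr : Γ.IsDistanceRegular) (hbip : Γ.IsBipartite)
    (hv : IsLocalVector Γ x η v) (j : ℕ) : Γ.distMatrix 1 *ᵥ ladder Γ x v (j + 1) =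
      (interC Γ (j + 2) : ℂ) • ladder Γ x v (j + 2) + lowerCoeff Γ η j • ladder Γ x v j := by
  rw [distMatrix_one_eq_raisingMatrix_add_loweringMatrix hdr.1 hbip x, Matrix.add_mulVec,
    hv.loweringMatrix_mulVec_ladder_succ hdr hbip,
    raisingMatrix_mulVec_ladder hdr hbip hv.support]

theorem exists_mulVec_ladder_eq_linearCombination (hdr : Γ.IsDistanceRegular)
    (hbip : Γ.IsBipartite) (x : X) (η : ℂ) {B : Matrix X X ℂ}
    (hB : B ∈ {Γ.distMatrix 1} ∪ Set.range (Γ.dualIdempotent x)) :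
    ∃ u : ℕ → ℕ →₀ ℂ, ∀ v, IsLocalVector Γ x η v → ∀ j,
      B *ᵥ ladder Γ x v j = Finsupp.linearCombination ℂ (ladder Γ x v) (u j) := by
  rcases hB with rfl | ⟨i, rfl⟩
  · refine ⟨fun
      | 0 => Finsupp.single 1 (interC Γ 1 : ℂ)
      | j + 1 => Finsupp.single (j + 2) (interC Γ (j + 2) : ℂ) +
          Finsupp.single j (lowerCoeff Γ η j), fun v hv j => ?_⟩
    cases j with
    | zero => simp [hv.distMatrix_one_mulVec_ladder_zero hdr hbip]
    | succ j => simp [hv.distMatrix_one_mulVec_ladder_succ hdr hbip]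
  · refine ⟨fun j => if i = j + 2 then Finsupp.single j 1 else 0, fun v _ j => ?_⟩
    by_cases h : i = j + 2 <;> simp [ladder, dualIdempotent_mulVec_component, h]

theorem exists_end_mulVecLin_comp_linearCombination (hdr : Γ.IsDistanceRegular)
    (hbip : Γ.IsBipartite) (x : X) (η : ℂ) {B : Matrix X X ℂ}
    (hB : B ∈ Γ.subconstituentAlgebra x) :
    ∃ M : Module.End ℂ (ℕ →₀ ℂ), ∀ v, IsLocalVector Γ x η v →
      B.mulVecLin ∘ₗ Finsupp.linearCombination ℂ (ladder Γ x v) =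
        Finsupp.linearCombination ℂ (ladder Γ x v) ∘ₗ M := by
  induction hB using Algebra.adjoin_induction with
  | mem B hB =>
    obtain ⟨u, hu⟩ := exists_mulVec_ladder_eq_linearCombination hdr hbip x η hB
    refine ⟨Finsupp.linearCombination ℂ u, fun v hv => Finsupp.lhom_ext fun j a => ?_⟩
    simp [hu v hv j]
  | algebraMap a =>
    refine ⟨a • LinearMap.id, fun v _ => Finsupp.lhom_ext fun j b => ?_⟩
    simp only [Algebra.algebraMap_eq_smul_one, LinearMap.comp_apply, Matrix.mulVecLin_apply,
      Matrix.one_mulVec, LinearMap.smul_apply, LinearMap.id_apply, map_smul]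
  | add B C _ _ hB hC =>
    obtain ⟨M, hM⟩ := hB
    obtain ⟨N, hN⟩ := hC
    refine ⟨M + N, fun v hv => ?_⟩
    rw [Matrix.mulVecLin_add, LinearMap.add_comp, hM v hv, hN v hv, LinearMap.comp_add]
  | mul B C _ _ hB hC =>
    obtain ⟨M, hM⟩ := hB
    obtain ⟨N, hN⟩ := hC
    refine ⟨M * N, fun v hv => ?_⟩
    rw [Matrix.mulVecLin_mul, LinearMap.comp_assoc, hN v hv, ← LinearMap.comp_assoc, hM v hv,
      LinearMap.comp_assoc, Module.End.mul_eq_comp]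

theorem dualIdempotent_mulVec_linearCombination_ladder (hc : Γ.Connected)
    (hv : Γ.dualIdempotent x 2 *ᵥ v = v) (u : ℕ →₀ ℂ) :
    Γ.dualIdempotent x 2 *ᵥ Finsupp.linearCombination ℂ (ladder Γ x v) u = u 0 • v := by
  induction u using Finsupp.induction_linear with
  | zero => simp
  | add u w hu hw => rw [map_add, Matrix.mulVec_add, hu, hw, Finsupp.add_apply, add_smul]
  | single j a =>
    rw [Finsupp.linearCombination_single, Matrix.mulVec_smul, ladder,
      dualIdempotent_mulVec_component]
    cases j with
    | zero => simp [component_zero hc hv]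
    | succ j => simp

theorem exists_dualIdempotent_mulVec_mulVec_eq_smul (hdr : Γ.IsDistanceRegular)
    (hbip : Γ.IsBipartite) (x : X) (η : ℂ) {B : Matrix X X ℂ}
    (hB : B ∈ Γ.subconstituentAlgebra x) :
    ∃ a : ℂ, ∀ v, IsLocalVector Γ x η v → Γ.dualIdempotent x 2 *ᵥ B *ᵥ v = a • v := by
  obtain ⟨M, hM⟩ := exists_end_mulVecLin_comp_linearCombination hdr hbip x η hB
  refine ⟨M (Finsupp.single 0 1) 0, fun v hv => ?_⟩
  have h := LinearMap.congr_fun (hM v hv) (Finsupp.single 0 1)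
  simp only [LinearMap.comp_apply, Finsupp.linearCombination_single, one_smul,
    Matrix.mulVecLin_apply, ladder_zero hdr.1 hv.support] at h
  rw [h, dualIdempotent_mulVec_linearCombination_ladder hdr.1 hv.support]

end IsLocalVector

end LocalVectors

section Modules

variable {X : Type*} [Fintype X] [DecidableEq X] {Γ : SimpleGraph X} {x : X}

theorem distMatrix_one_mem_subconstituentAlgebra :
    Γ.distMatrix 1 ∈ Γ.subconstituentAlgebra x :=
  Algebra.subset_adjoin (Or.inl rfl)

theorem dualIdempotent_mem_subconstituentAlgebra (i : ℕ) :
    Γ.dualIdempotent x i ∈ Γ.subconstituentAlgebra x :=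
  Algebra.subset_adjoin (Or.inr ⟨i, rfl⟩)

theorem distMatrix_mem_subconstituentAlgebra (hdr : Γ.IsDistanceRegular) (hbip : Γ.IsBipartite)
    (j : ℕ) : Γ.distMatrix j ∈ Γ.subconstituentAlgebra x := by
  induction j using Nat.twoStepInduction with
  | zero => exact distMatrix_zero hdr.1 ▸ one_mem _
  | one => exact distMatrix_one_mem_subconstituentAlgebra
  | more j hj hj1 =>
    by_cases hc : interC Γ (j + 2) = 0
    · exact distMatrix_eq_zero_of_interC_eq_zero hdr hc ▸ zero_mem _
    have hrec : Γ.distMatrix (j + 2) = (interC Γ (j + 2) : ℂ)⁻¹ •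
        (Γ.distMatrix 1 * Γ.distMatrix (j + 1) - (Γ.interB j : ℂ) • Γ.distMatrix j) := by
      rw [distMatrix_one_mul_distMatrix_succ hdr hbip, add_sub_cancel_right,
        inv_smul_smul₀ (Nat.cast_ne_zero.2 hc)]
    rw [hrec]
    exact Subalgebra.smul_mem _ (sub_mem
      (mul_mem distMatrix_one_mem_subconstituentAlgebra hj1) (Subalgebra.smul_mem _ hj _)) _

variable {W W' : Γ.TModule x}

theorem mem_subconstituent {i : ℕ} {v : X → ℂ} :
    v ∈ W.subconstituent i ↔ v ∈ W.carrier ∧ Γ.dualIdempotent x i *ᵥ v = v := by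
  constructor
  · rintro ⟨w, hw, rfl⟩
    refine ⟨W.invariant _ (dualIdempotent_mem_subconstituentAlgebra i) w hw, ?_⟩
    rw [Matrix.mulVecLin_apply, Matrix.mulVec_mulVec, dualIdempotent_mul_dualIdempotent,
      if_pos rfl]
  · exact fun ⟨hv, hfix⟩ => ⟨v, hv, hfix⟩

theorem component_mem_subconstituent (hdr : Γ.IsDistanceRegular) (hbip : Γ.IsBipartite)
    {v : X → ℂ} (hv : v ∈ W.carrier) (i j : ℕ) : component Γ x v i j ∈ W.subconstituent i :=
  Submodule.mem_map_of_mem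
    (W.invariant _ (distMatrix_mem_subconstituentAlgebra hdr hbip j) v hv)

theorem subconstituent_eq_bot_of_diam_lt (hc : Γ.Connected) {i : ℕ} (h : Γ.diam < i) :
    W.subconstituent i = ⊥ := by
  rw [TModule.subconstituent, dualIdempotent_eq_zero hc h, Matrix.mulVecLin_zero,
    Submodule.map_zero]

theorem subconstituent_eq_bot_of_lt_endpoint (hc : Γ.Connected) {i : ℕ} (h : i < W.endpoint) :
    W.subconstituent i = ⊥ := by
  rcases lt_or_ge Γ.diam i with hi | hi
  · exact subconstituent_eq_bot_of_diam_lt hc hi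
  · by_contra hne
    exact Nat.notMem_of_lt_sInf h ⟨hi, hne⟩

theorem finrank_subconstituent_le_one (hc : Γ.Connected) (hthin : W.IsThin) (i : ℕ) :
    Module.finrank ℂ (W.subconstituent i) ≤ 1 := by
  rcases lt_or_ge Γ.diam i with hi | hi
  · rw [subconstituent_eq_bot_of_diam_lt hc hi, finrank_bot]
    exact zero_le_one
  · exact hthin i hi

theorem mem_span_singleton_of_mem_subconstituent (hc : Γ.Connected) (hthin : W.IsThin) {i : ℕ}
    {u w : X → ℂ} (hu : u ∈ W.subconstituent i) (hw : w ∈ W.subconstituent i) (hw0 : w ≠ 0) :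
    u ∈ ℂ ∙ w := by
  have hspan : ℂ ∙ w = W.subconstituent i := by
    refine Submodule.eq_of_le_of_finrank_le ((Submodule.span_singleton_le_iff_mem _ _).2 hw) ?_
    rw [finrank_span_singleton hw0]
    exact finrank_subconstituent_le_one hc hthin i
  rwa [hspan]

theorem component_zero_apply_self {r : ℕ} {v : X → ℂ}
    (hv : Γ.dualIdempotent x r *ᵥ v = v) : component Γ x v 0 r x = ∑ y, v y := by
  rw [component_apply, if_pos dist_self]
  exact Finset.sum_congr rfl fun z _ =>
    ite_eq_left_iff.2 fun hz => (apply_eq_zero_of_dist_ne hv hz).symm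

theorem exists_isLocalVector_mem_carrier (hdr : Γ.IsDistanceRegular) (hbip : Γ.IsBipartite)
    (hthin : W.IsThin) (hend : W.endpoint = 2) {η : ℝ} (hloc : W.HasLocalEigenvalue η) :
    ∃ v ∈ W.carrier, IsLocalVector Γ x η v := by
  obtain ⟨v, hv, hv0⟩ := Submodule.exists_mem_ne_zero_of_ne_bot hloc.1
  obtain ⟨hvW, hfix⟩ := mem_subconstituent.1 hv
  have hcomp (i j : ℕ) := component_mem_subconstituent hdr hbip hvW i j
  have hvanish {i : ℕ} (hi : i < 2) (j : ℕ) : component Γ x v i j = 0 := by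
    rw [← Submodule.mem_bot ℂ, ← subconstituent_eq_bot_of_lt_endpoint hdr.1 (hi.trans_eq hend.symm)]
    exact hcomp i j
  refine ⟨v, hvW, hv0, hfix, ?_, hvanish one_lt_two 1, ?_, fun j hj => ?_⟩
  · rw [← component_zero_apply_self hfix, hvanish two_pos, Pi.zero_apply]
  · rw [← hloc.2 v hv, ← Matrix.mulVec_mulVec, ← Matrix.mulVec_mulVec, hfix, component]
  · exact mem_span_singleton_of_mem_subconstituent hdr.1 hthin (hcomp _ _) (hcomp _ _) hj

end Modules

section Isomorphism

variable {X : Type*} [Fintype X] [DecidableEq X] {Γ : SimpleGraph X} {x : X} {W W' : Γ.TModule x}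

/-- The map `B ↦ B v` from `T(x)` to the `T(x)`-module `W`; if `W` is irreducible and `v ≠ 0`, it
presents `W` as a quotient of `T(x)`. -/
def orbitMap (W : Γ.TModule x) (v : W.carrier) :
    Γ.subconstituentAlgebra x →ₗ[ℂ] W.carrier where
  toFun B := ⟨(B : Matrix X X ℂ) *ᵥ (v : X → ℂ), W.invariant _ B.2 _ v.2⟩
  map_add' _ _ := Subtype.ext (Matrix.add_mulVec _ _ _)
  map_smul' _ _ := Subtype.ext (Matrix.smul_mulVec _ _ _)

theorem orbitMap_surjective (hW : W.IsIrreducible) {v : W.carrier} (hv : v ≠ 0) :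
    Function.Surjective (orbitMap W v) := by
  let orbit : Γ.TModule x :=
    { carrier := (LinearMap.range (orbitMap W v)).map W.carrier.subtype
      invariant := by
        rintro B hB _ ⟨_, ⟨C, rfl⟩, rfl⟩
        exact ⟨_, ⟨⟨B, hB⟩ * C, rfl⟩, (Matrix.mulVec_mulVec _ _ _).symm⟩ }
  have hv_mem : (v : X → ℂ) ∈ orbit.carrier := ⟨_, ⟨1, rfl⟩, Matrix.one_mulVec _⟩
  have horbit : orbit.carrier = W.carrier := by
    refine (hW.2 orbit (Submodule.map_subtype_le _ _)).resolve_left fun hbot => hv ?_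
    rw [hbot, Submodule.mem_bot] at hv_mem
    exact Subtype.ext hv_mem
  rintro ⟨w, hw⟩
  rw [← horbit] at hw
  obtain ⟨_, ⟨B, rfl⟩, rfl⟩ := hw
  exact ⟨B, rfl⟩

theorem exists_mem_mulVec_eq (hW : W.IsIrreducible) {v w : X → ℂ} (hv : v ∈ W.carrier)
    (hv0 : v ≠ 0) (hw : w ∈ W.carrier) : ∃ B ∈ Γ.subconstituentAlgebra x, B *ᵥ v = w := by
  obtain ⟨B, hB⟩ := orbitMap_surjective hW (v := ⟨v, hv⟩) (by simpa using hv0) ⟨w, hw⟩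
  exact ⟨B, B.2, congrArg Subtype.val hB⟩

theorem isIsomorphic_of_ker_orbitMap_eq {v : W.carrier} {v' : W'.carrier}
    (hv : Function.Surjective (orbitMap W v)) (hv' : Function.Surjective (orbitMap W' v'))
    (hker : LinearMap.ker (orbitMap W v) = LinearMap.ker (orbitMap W' v')) :
    W.IsIsomorphic W' := by
  let σ : W.carrier ≃ₗ[ℂ] W'.carrier :=
    ((orbitMap W v).quotKerEquivOfSurjective hv).symm ≪≫ₗ
      Submodule.quotEquivOfEq _ _ hker ≪≫ₗ (orbitMap W' v').quotKerEquivOfSurjective hv'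
  have hσ (B : Γ.subconstituentAlgebra x) : σ (orbitMap W v B) = orbitMap W' v' B := by
    simp [σ]
  refine ⟨σ, fun B hB w => ?_⟩
  obtain ⟨C, rfl⟩ := hv w
  have hBC : orbitMap W v (⟨B, hB⟩ * C) =
      ⟨B *ᵥ (orbitMap W v C : X → ℂ), W.invariant B hB _ (orbitMap W v C).2⟩ :=
    Subtype.ext (Matrix.mulVec_mulVec _ _ _).symm
  rw [← hBC, hσ, hσ]
  exact (Matrix.mulVec_mulVec _ _ _).symm

theorem mulVec_eq_zero_of_forall_exists_smul (hW' : W'.IsIrreducible) {i : ℕ}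
    {v v' : X → ℂ} (hv : v ≠ 0) (hv' : v' ∈ W'.carrier)
    (hfix' : Γ.dualIdempotent x i *ᵥ v' = v')
    (hscalar : ∀ B ∈ Γ.subconstituentAlgebra x, ∃ a : ℂ,
      Γ.dualIdempotent x i *ᵥ B *ᵥ v = a • v ∧ Γ.dualIdempotent x i *ᵥ B *ᵥ v' = a • v')
    {B : Matrix X X ℂ} (hB : B ∈ Γ.subconstituentAlgebra x) (h : B *ᵥ v = 0) : B *ᵥ v' = 0 := by
  by_contra hne
  obtain ⟨C, hC, hCB⟩ := exists_mem_mulVec_eq hW' (W'.invariant B hB v' hv') hne hv'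
  obtain ⟨a, ha, ha'⟩ := hscalar (C * B) (mul_mem hC hB)
  rw [← Matrix.mulVec_mulVec, h, Matrix.mulVec_zero, Matrix.mulVec_zero, eq_comm, smul_eq_zero,
    or_iff_left hv] at ha
  rw [← Matrix.mulVec_mulVec, hCB, hfix', ha, zero_smul] at ha'
  exact hne (by rw [ha', Matrix.mulVec_zero])

theorem isIsomorphic_of_forall_exists_smul (hW : W.IsIrreducible) (hW' : W'.IsIrreducible) {i : ℕ}
    {v v' : X → ℂ} (hv : v ∈ W.carrier) (hv' : v' ∈ W'.carrier) (hv0 : v ≠ 0) (hv0' : v' ≠ 0)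
    (hfix : Γ.dualIdempotent x i *ᵥ v = v) (hfix' : Γ.dualIdempotent x i *ᵥ v' = v')
    (hscalar : ∀ B ∈ Γ.subconstituentAlgebra x, ∃ a : ℂ,
      Γ.dualIdempotent x i *ᵥ B *ᵥ v = a • v ∧ Γ.dualIdempotent x i *ᵥ B *ᵥ v' = a • v') :
    W.IsIsomorphic W' := by
  refine isIsomorphic_of_ker_orbitMap_eq (v := ⟨v, hv⟩) (v' := ⟨v', hv'⟩)
    (orbitMap_surjective hW (by simpa using hv0)) (orbitMap_surjective hW' (by simpa using hv0')) ?_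
  ext B
  simp only [LinearMap.mem_ker, orbitMap, LinearMap.coe_mk, AddHom.coe_mk, Submodule.mk_eq_zero]
  exact ⟨mulVec_eq_zero_of_forall_exists_smul hW' hv0 hv' hfix' hscalar B.2,
    mulVec_eq_zero_of_forall_exists_smul hW hv0' hv hfix
      (fun C hC => (hscalar C hC).imp fun _ => And.symm) B.2⟩

theorem isIsomorphic_of_hasLocalEigenvalue (hdr : Γ.IsDistanceRegular) (hbip : Γ.IsBipartite)
    {η : ℝ} (hW : W.IsIrreducible) (hthin : W.IsThin) (hend : W.endpoint = 2)
    (hloc : W.HasLocalEigenvalue η) (hW' : W'.IsIrreducible) (hthin' : W'.IsThin)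
    (hend' : W'.endpoint = 2) (hloc' : W'.HasLocalEigenvalue η) : W.IsIsomorphic W' := by
  obtain ⟨v, hvW, hv⟩ := exists_isLocalVector_mem_carrier hdr hbip hthin hend hloc
  obtain ⟨v', hvW', hv'⟩ := exists_isLocalVector_mem_carrier hdr hbip hthin' hend' hloc'
  refine isIsomorphic_of_forall_exists_smul hW hW' hvW hvW' hv.ne_zero hv'.ne_zero hv.support
    hv'.support fun B hB => ?_
  obtain ⟨a, ha⟩ := IsLocalVector.exists_dualIdempotent_mulVec_mulVec_eq_smul hdr hbip x η hB
  exact ⟨a, ha v hv, ha v' hv'⟩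

/-- `σ` commutes with the action of `T(x)`. -/
def IsEquivariant (σ : W.carrier ≃ₗ[ℂ] W'.carrier) : Prop :=
  ∀ (B : Matrix X X ℂ) (hB : B ∈ Γ.subconstituentAlgebra x) (w : W.carrier),
    (σ ⟨B *ᵥ (w : X → ℂ), W.invariant B hB w w.2⟩ : X → ℂ) = B *ᵥ (σ w : X → ℂ)

namespace IsEquivariant

variable {σ : W.carrier ≃ₗ[ℂ] W'.carrier}

theorem mulVec_eq_smul_iff (hσ : IsEquivariant σ) {B : Matrix X X ℂ}
    (hB : B ∈ Γ.subconstituentAlgebra x) (w : W.carrier) (μ : ℂ) :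
    B *ᵥ (σ w : X → ℂ) = μ • (σ w : X → ℂ) ↔ B *ᵥ (w : X → ℂ) = μ • (w : X → ℂ) := by
  rw [← hσ B hB w, ← Submodule.coe_smul, ← map_smul, Subtype.coe_inj, σ.injective.eq_iff,
    Subtype.ext_iff, Submodule.coe_smul]

theorem mem_subconstituent_iff (hσ : IsEquivariant σ) (i : ℕ) (w : W.carrier) :
    (σ w : X → ℂ) ∈ W'.subconstituent i ↔ (w : X → ℂ) ∈ W.subconstituent i := by
  have h := hσ.mulVec_eq_smul_iff (dualIdempotent_mem_subconstituentAlgebra i) w 1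
  simp only [one_smul] at h
  simp only [mem_subconstituent, SetLike.coe_mem, true_and, h]

theorem finrank_subconstituent_eq (hσ : IsEquivariant σ) (i : ℕ) :
    Module.finrank ℂ (W'.subconstituent i) = Module.finrank ℂ (W.subconstituent i) := by
  have hle (V : Γ.TModule x) : V.subconstituent i ≤ V.carrier :=
    fun _ hv => (mem_subconstituent.1 hv).1
  have hmap : ((W.subconstituent i).submoduleOf W.carrier).map σ.toLinearMap =
      (W'.subconstituent i).submoduleOf W'.carrier := by
    ext w'
    obtain ⟨w, rfl⟩ := σ.surjective w'
    simp [Submodule.submoduleOf, hσ.mem_subconstituent_iff]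
  rw [← (Submodule.submoduleOfEquivOfLe (hle W')).finrank_eq, ← hmap,
    LinearEquiv.finrank_map_eq, (Submodule.submoduleOfEquivOfLe (hle W)).finrank_eq]

end IsEquivariant

theorem isThin_of_isIsomorphic (h : W.IsIsomorphic W') (hthin : W.IsThin) : W'.IsThin := by
  obtain ⟨σ, hσ : IsEquivariant σ⟩ := h
  exact fun i hi => (hσ.finrank_subconstituent_eq i).trans_le (hthin i hi)

theorem endpoint_eq_of_isIsomorphic (h : W.IsIsomorphic W') : W'.endpoint = W.endpoint := by
  obtain ⟨σ, hσ : IsEquivariant σ⟩ := h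
  simp only [TModule.endpoint, Ne, ← Submodule.finrank_eq_zero (R := ℂ),
    hσ.finrank_subconstituent_eq]

theorem hasLocalEigenvalue_of_isIsomorphic (hdr : Γ.IsDistanceRegular) (hbip : Γ.IsBipartite)
    (h : W.IsIsomorphic W') {η : ℝ} (hloc : W.HasLocalEigenvalue η) :
    W'.HasLocalEigenvalue η := by
  obtain ⟨σ, hσ : IsEquivariant σ⟩ := h
  refine ⟨?_, fun w' hw' => ?_⟩
  · rw [Ne, ← Submodule.finrank_eq_zero (R := ℂ), hσ.finrank_subconstituent_eq,
      Submodule.finrank_eq_zero]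
    exact hloc.1
  · have hE := dualIdempotent_mem_subconstituentAlgebra (Γ := Γ) (x := x) 2
    obtain ⟨w, hw⟩ := σ.surjective ⟨w', (mem_subconstituent.1 hw').1⟩
    obtain rfl : (σ w : X → ℂ) = w' := congrArg Subtype.val hw
    exact (hσ.mulVec_eq_smul_iff
      (mul_mem (mul_mem hE (distMatrix_mem_subconstituentAlgebra hdr hbip 2)) hE) w η).2
      (hloc.2 w ((hσ.mem_subconstituent_iff 2 w).1 hw'))

end Isomorphism

end Terwilliger

theorem mainTheorem11_general {X : Type*} [Fintype X] [DecidableEq X] (Γ : SimpleGraph X)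
    (hdr : Γ.IsDistanceRegular) (hbip : Γ.IsBipartite) (x : X) (η : ℝ)
    (W : Γ.TModule x) (hW : W.IsIrreducible) (hWthin : W.IsThin) (hWend : W.endpoint = 2)
    (hWloc : W.HasLocalEigenvalue η) (W' : Γ.TModule x) (hW' : W'.IsIrreducible) :
    W.IsIsomorphic W' ↔ W'.IsThin ∧ W'.endpoint = 2 ∧ W'.HasLocalEigenvalue η := by
  constructor
  · intro h
    exact ⟨Terwilliger.isThin_of_isIsomorphic h hWthin,
      (Terwilliger.endpoint_eq_of_isIsomorphic h).trans hWend,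
      Terwilliger.hasLocalEigenvalue_of_isIsomorphic hdr hbip h hWloc⟩
  · rintro ⟨hthin, hend, hloc⟩
    exact Terwilliger.isIsomorphic_of_hasLocalEigenvalue hdr hbip hW hWthin hWend hWloc hW' hthin
      hend hloc

theorem mainTheorem11 {X : Type*} [Fintype X] [DecidableEq X] (Γ : SimpleGraph X)
    (hdr : Γ.IsDistanceRegular) (hbip : Γ.IsBipartite)
    (hD : 4 ≤ Γ.diam) (hk : 3 ≤ Γ.interB 0) (x : X)
    (n : ℕ) (hn : n = 1 ∨ (Odd Γ.diam ∧ n = Γ.diam / 2))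
    (W : Γ.TModule x) (hW : W.IsIrreducible) (hWthin : W.IsThin) (hWend : W.endpoint = 2)
    (hWloc : W.HasLocalEigenvalue (Γ.thetaTilde n))
    (W' : Γ.TModule x) (hW' : W'.IsIrreducible) :
    W.IsIsomorphic W' ↔
      W'.IsThin ∧ W'.endpoint = 2 ∧ W'.HasLocalEigenvalue (Γ.thetaTilde n) :=
  mainTheorem11_general Γ hdr hbip x (Γ.thetaTilde n) W hW hWthin hWend hWloc W' hW'
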